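/- **Setting.** Let $X_1,X_2,\dots$ be real random variables on a probability space $(\Omega,P)$ with common distribution function $F$ (for instance a stationary sequence with stationary distribution $F$). For each $n$ let $X^*_{1,n},\dots,X^*_{m_n,n}$ ($m_n\ge 1$) be real random variables on $\Omega$, the bootstrap sample; nothing is assumed on its structure. Put, for $t\in\mathbb{R}$, $$\mathbb{G}_n(t)=\frac1{\sqrt n}\sum_{i=1}^n\{1_{(-\infty,t]}(X_i)-F(t)\},\qquad \mathbb{G}_n^*(t)=\sqrt{m_n}\Big(\frac1{m_n}\sum_{i=1}^{m_n}1_{(-\infty,t]}(X^*_{i,n})-\frac1n\sum_{i=1}^{n}1_{(-\infty,t]}(X_i)\Big).$$ For $0<T<\infty$ let $BV_T'$ be the set of right-continuous $g:\mathbb{R}\to\mathbb{R}$ with total variation at most $T$ and $\sup_x|g(x)|\le T$, and let $\mathcal{G}\subseteq BV_T'$. The integrals $\int g\,d\mathbb{G}_n$ and $\int g\,d\mathbb{G}_n^*$ are Lebesgue–Stieltjes integrals. Weak convergence in $\ell^\infty(\mathbb{R})$ and $\ell^\infty(\mathcal{G})$ (with the supremum norms) is in the sense of Hoffmann-Jørgensen,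 with outer expectations. For processes $Y_n^*$ that depend on the sample and the bootstrap sample, with values in $E=\ell^\infty(\mathbb{R})$ or $E=\ell^\infty(\mathcal{G})$, "conditionally on $X_1,\dots,X_n$, $Y_n^*$ converges weakly to $Y$ in probability (respectively almost surely)" means that $$d_{BL}(Y_n^*,Y)=\sup_h\big|\mathbb{E}^*h(Y_n^*)-\mathbb{E}h(Y)\big|\to0$$ in probability (respectively almost surely), where the supremum is over all $h:E\to\mathbb{R}$ with $|h|\le1$ and $|h(x)-h(y)|\le\|x-y\|_\infty$, and $\mathbb{E}^*$ is the outer expectation over the bootstrap sample, conditionally on $X_1,\dots,X_n$. **Theorem 6.** Assume that, conditionally on $X_1,\dots,X_n$, $\{\mathbb{G}_n^*(t),\,t\in\mathbb{R}\}$ converges weakly in $\ell^\infty(\mathbb{R})$, in probability or almost surely, to a Gaussian process $\mathbb{Z}$ whose sample paths are almost surely uniformly continuous for the distance $d(s,t)=|F(s)-F(t)|$. Then there is a Gaussian process $\bar{\mathbb{Z}}$ indexed by $\mathcal{G}$, whose sample paths are bounded and uniformly continuous for the $L_1(F)$-distance $\int|f-g|\,dF$, which is (almost surely equal to) a strongly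 measurable random element of $\ell^\infty(\mathcal{G})$, and such that the following hold. 1. If the convergence of $\mathbb{G}_n^*$ to $\mathbb{Z}$ holds in probability, then, conditionally on $X_1,\dots,X_n$, $\{\int g\,d\mathbb{G}_n^*,\ g\in\mathcal{G}\}$ converges weakly to $\bar{\mathbb{Z}}$ in $\ell^\infty(\mathcal{G})$, in probability. 2. If the convergence of $\mathbb{G}_n^*$ to $\mathbb{Z}$ holds almost surely, then so does the weak convergence of $\{\int g\,d\mathbb{G}_n^*,\ g\in\mathcal{G}\}$ to $\bar{\mathbb{Z}}$ in $\ell^\infty(\mathcal{G})$. 3. If $\{\mathbb{G}_n(t),\,t\in\mathbb{R}\}$ also converges weakly to $\mathbb{Z}$ in $\ell^\infty(\mathbb{R})$, then $\{\int g\,d\mathbb{G}_n,\ g\in\mathcal{G}\}$ converges weakly in $\ell^\infty(\mathcal{G})$ to the same $\bar{\mathbb{Z}}$. -/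

import Mathlib

open MeasureTheory ProbabilityTheory Filter Set
open scoped ENNReal Topology BoundedContinuousFunction

noncomputable section

/-! ### The space of bounded functions, and functions of bounded variation -/

/-- The Banach space `ℓ^∞(ι)` of bounded real functions on `ι`, with the supremum norm. -/
abbrev Linf (ι : Type*) : Type _ := lp (fun _ : ι => ℝ) ⊤

/-- The class of right-continuous functions `g : ℝ → ℝ` with total variation at most `T` and
supremum norm at most `T`. -/
def BVright (T : ℝ) : Set (ℝ → ℝ) :=
  {g | eVariationOn g univ ≤ ENNReal.ofReal T ∧ (∀ x, |g x| ≤ T) ∧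
    ∀ x, ContinuousWithinAt g (Ici x) x}

theorem memLinf_of_bv {z : ℝ → ℝ} (hz : BoundedVariationOn z univ) :
    Memℓp (E := fun _ : ℝ => ℝ) z ⊤ := by
  refine memℓp_infty ⟨‖z 0‖ + (eVariationOn z univ).toReal, ?_⟩
  rintro _ ⟨t, rfl⟩
  have h := hz.dist_le (mem_univ t) (mem_univ (0 : ℝ))
  have h2 : ‖z t‖ ≤ ‖z 0‖ + ‖z t - z 0‖ := by
    calc ‖z t‖ = ‖z 0 + (z t - z 0)‖ := by congr 1; ring
      _ ≤ _ := norm_add_le _ _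
  rw [dist_eq_norm] at h
  linarith

/-- A function of bounded variation on `ℝ`, as an element of `ℓ^∞(ℝ)`. -/
def pathInLinf (z : ℝ → ℝ) (hz : BoundedVariationOn z univ) : Linf ℝ :=
  ⟨z, memLinf_of_bv hz⟩

/-- The Lebesgue-Stieltjes integral `∫ g dz` with respect to a function `z` of bounded variation,
that is, the integral against the signed measure that `z` generates. -/
def lsIntegral (g z : ℝ → ℝ) (hz : BoundedVariationOn z univ) : ℝ :=
  ∫ᵛ x, g x ∂•(hz.vectorMeasure)

theorem memLinf_lsIntegral {T : ℝ} {𝒢 : Set (ℝ → ℝ)} (h𝒢 : 𝒢 ⊆ BVright T) (z : ℝ → ℝ)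
    (hz : BoundedVariationOn z univ) :
    Memℓp (E := fun _ : 𝒢 => ℝ) (fun g => lsIntegral g z hz) ⊤ := by
  have hfin : IsFiniteMeasure hz.vectorMeasure.variation := by
    rw [← SignedMeasure.totalVariation_eq_variation]
    unfold SignedMeasure.totalVariation
    infer_instance
  refine memℓp_infty ⟨T * ‖ContinuousLinearMap.lsmul ℝ ℝ (E := ℝ)‖ *
    hz.vectorMeasure.variation.real univ, ?_⟩
  rintro _ ⟨g, rfl⟩
  exact VectorMeasure.norm_integral_le_of_norm_le_const
    (Eventually.of_forall fun x => (h𝒢 g.2).2.1 x)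

/-- The process `{∫ g dz, g ∈ 𝒢}` as an element of `ℓ^∞(𝒢)`, for `𝒢` contained in `BVright T`. -/
def integralProcess {T : ℝ} {𝒢 : Set (ℝ → ℝ)} (h𝒢 : 𝒢 ⊆ BVright T) (z : ℝ → ℝ)
    (hz : BoundedVariationOn z univ) : Linf 𝒢 :=
  ⟨fun g => lsIntegral g z hz, memLinf_lsIntegral h𝒢 z hz⟩

/-! ### The empirical process and the bootstrap empirical process -/

/-- The number `1_{(-∞, t]}(x)`. -/
def stepAt (x t : ℝ) : ℝ := indicator (Iic t) (fun _ => (1 : ℝ)) x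

/-- The empirical process `n^{-1/2} ∑_{i ≤ n} (1_{(-∞, t]}(x_i) - F t)` of the sample `x`. -/
def empProcess (F : ℝ → ℝ) (n : ℕ) (x : Fin n → ℝ) (t : ℝ) : ℝ :=
  1 / √(n : ℝ) * ∑ i, (stepAt (x i) t - F t)

/-- The bootstrap empirical process
`m^{1/2} (m^{-1} ∑_{i ≤ m} 1_{(-∞, t]}(x*_i) - n^{-1} ∑_{i ≤ n} 1_{(-∞, t]}(x_i))`
of the sample `x` and the bootstrap sample `xs`. -/
def bootProcess (n m : ℕ) (x : Fin n → ℝ) (xs : Fin m → ℝ) (t : ℝ) : ℝ :=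
  √(m : ℝ) * (1 / (m : ℝ) * ∑ i, stepAt (xs i) t - 1 / (n : ℝ) * ∑ i, stepAt (x i) t)

theorem stepAt_monotone (x : ℝ) : Monotone (stepAt x) := by
  intro s t hst
  unfold stepAt
  by_cases h : x ≤ s
  · simp [h, h.trans hst]
  · by_cases h' : x ≤ t <;> simp [h, h']

theorem stepAt_mem (x t : ℝ) : 0 ≤ stepAt x t ∧ stepAt x t ≤ 1 := by
  unfold stepAt
  by_cases h : x ≤ t <;> simp [h]

theorem bv_sub_of_monotone {a b : ℝ → ℝ} (ha : Monotone a) (hb : Monotone b) {A B : ℝ}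
    (hA : ∀ x, |a x| ≤ A) (hB : ∀ x, |b x| ≤ B) :
    BoundedVariationOn (fun t => a t - b t) univ := by
  have ha' := (ha.monotoneOn univ).boundedVariationOn fun x _ => hA x
  have hb' := (hb.monotoneOn univ).boundedVariationOn fun x _ => hB x
  refine ne_of_lt (lt_of_le_of_lt ?_ (ENNReal.add_lt_top.2 ⟨ha'.lt_top, hb'.lt_top⟩))
  refine iSup_le fun p => ?_
  calc ∑ i ∈ Finset.range p.1, edist (a (p.2.1 (i + 1)) - b (p.2.1 (i + 1)))
          (a (p.2.1 i) - b (p.2.1 i))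
      ≤ ∑ i ∈ Finset.range p.1, (edist (a (p.2.1 (i + 1))) (a (p.2.1 i)) +
          edist (b (p.2.1 (i + 1))) (b (p.2.1 i))) := by
        refine Finset.sum_le_sum fun i _ => ?_
        simp only [edist_eq_enorm_sub]
        rw [sub_sub_sub_comm]
        exact enorm_sub_le
    _ ≤ _ := by
        rw [Finset.sum_add_distrib]
        exact add_le_add (eVariationOn.sum_le p.2.2.1 fun i => mem_univ _)
          (eVariationOn.sum_le p.2.2.1 fun i => mem_univ _)

theorem sum_stepAt_monotone {n : ℕ} (x : Fin n → ℝ) {c : ℝ} (hc : 0 ≤ c) :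
    Monotone fun t => c * ∑ i, stepAt (x i) t := fun _ _ hst =>
  mul_le_mul_of_nonneg_left (Finset.sum_le_sum fun i _ => stepAt_monotone (x i) hst) hc

theorem sum_stepAt_bound {n : ℕ} (x : Fin n → ℝ) {c : ℝ} (hc : 0 ≤ c) (t : ℝ) :
    |c * ∑ i, stepAt (x i) t| ≤ c * n := by
  rw [abs_of_nonneg (mul_nonneg hc (Finset.sum_nonneg fun i _ => (stepAt_mem (x i) t).1))]
  refine mul_le_mul_of_nonneg_left ?_ hc
  calc ∑ i, stepAt (x i) t ≤ ∑ _i : Fin n, (1 : ℝ) :=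
        Finset.sum_le_sum fun i _ => (stepAt_mem (x i) t).2
    _ = n := by simp

theorem bv_empProcess (ν : Measure ℝ) (n : ℕ) (x : Fin n → ℝ) :
    BoundedVariationOn (empProcess (cdf ν) n x) univ := by
  have hc : (0 : ℝ) ≤ 1 / √(n : ℝ) := by positivity
  have hd : (0 : ℝ) ≤ 1 / √(n : ℝ) * n := by positivity
  have h := bv_sub_of_monotone (sum_stepAt_monotone x hc)
    (b := fun t => 1 / √(n : ℝ) * n * cdf ν t)
    (fun _ _ hst => mul_le_mul_of_nonneg_left (monotone_cdf ν hst) hd)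
    (sum_stepAt_bound x hc) (B := 1 / √(n : ℝ) * n) (fun t => by
      rw [abs_of_nonneg (mul_nonneg hd (cdf_nonneg ν t))]
      exact mul_le_of_le_one_right hd (cdf_le_one ν t))
  convert h using 2 with t
  simp only [empProcess, Finset.sum_sub_distrib, Finset.sum_const, Finset.card_univ,
    Fintype.card_fin, nsmul_eq_mul]
  ring

theorem bv_bootProcess (n m : ℕ) (x : Fin n → ℝ) (xs : Fin m → ℝ) :
    BoundedVariationOn (bootProcess n m x xs) univ := by
  have hc : (0 : ℝ) ≤ √(m : ℝ) * (1 / (m : ℝ)) := by positivity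
  have hd : (0 : ℝ) ≤ √(m : ℝ) * (1 / (n : ℝ)) := by positivity
  have h := bv_sub_of_monotone (sum_stepAt_monotone xs hc) (sum_stepAt_monotone x hd)
    (sum_stepAt_bound xs hc) (sum_stepAt_bound x hd)
  convert h using 2 with t
  simp only [bootProcess]
  ring

/-! ### Weak convergence in the sense of Hoffmann-Jørgensen -/

/-- The outer expectation of a real-valued map `f`, not necessarily measurable: the infimum of the
expectations of the integrable measurable functions that lie above `f`. -/
def outerExp {α : Type*} [MeasurableSpace α] (μ : Measure α) (f : α → ℝ) : ℝ :=
  sInf {r | ∃ u : α → ℝ, Measurable u ∧ Integrable u μ ∧ (∀ a, f a ≤ u a) ∧ r = ∫ a, u a ∂μ}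

/-- The maps `Y n` (not necessarily measurable) converge weakly to the random element `Z`, in the
sense of Hoffmann-Jørgensen. -/
def WeakConv {α β E : Type*} [MeasurableSpace α] [MeasurableSpace β] [TopologicalSpace E]
    (P : Measure α) (Y : ℕ → α → E) (Q : Measure β) (Z : β → E) : Prop :=
  ∀ h : E →ᵇ ℝ, Tendsto (fun n => outerExp P fun a => h (Y n a)) atTop (𝓝 (∫ b, h (Z b) ∂Q))

/-- The functionals on `E` that are bounded by `1` and Lipschitz with constant `1`. -/
def BL1 (E : Type*) [NormedAddCommGroup E] : Set (E → ℝ) :=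
  {h | (∀ x, |h x| ≤ 1) ∧ ∀ x y, |h x - h y| ≤ ‖x - y‖}

/-- The bounded Lipschitz distance between `Y` (under `μ`) and `Z` (under `Q`). -/
def dBL {α β E : Type*} [MeasurableSpace α] [MeasurableSpace β] [NormedAddCommGroup E]
    (μ : Measure α) (Y : α → E) (Q : Measure β) (Z : β → E) : ℝ :=
  ⨆ h : BL1 E, |outerExp μ (fun a => h.1 (Y a)) - ∫ b, h.1 (Z b) ∂Q|

/-- The bounded Lipschitz distance between `Y(S, S*)` and `Z`, conditionally on the sample `S`,
as a random variable: the (outer) expectation `E*` is over the conditional distribution of the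
bootstrap sample `S*` given `S`, and `S` is held fixed at its observed value. -/
def condDBL {Ω Ω' E : Type*} [MeasurableSpace Ω] [MeasurableSpace Ω'] [NormedAddCommGroup E]
    (P : Measure Ω) [IsFiniteMeasure P] {n m : ℕ} (S : Ω → Fin n → ℝ) (Ss : Ω → Fin m → ℝ)
    (Y : (Fin n → ℝ) → (Fin m → ℝ) → E) (Q : Measure Ω') (Z : Ω' → E) (ω : Ω) : ℝ :=
  dBL (condDistrib Ss S P (S ω)) (fun xs => Y (S ω) xs) Q Z

/-- The first `n` observations. -/
def sample {Ω : Type*} (X : ℕ → Ω → ℝ) (n : ℕ) (ω : Ω) : Fin n → ℝ := fun i => X i ω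

/-- The bootstrap sample, as a random vector. -/
def bootSample {Ω : Type*} {m : ℕ} (Xs : Fin m → Ω → ℝ) (ω : Ω) : Fin m → ℝ := fun i => Xs i ω

/-- Conditionally on the sample, `Y n (sample) (bootstrap sample)` converges weakly to `Z`,
in probability. -/
def CondWeakInProb {Ω Ω' E : Type*} [MeasurableSpace Ω] [MeasurableSpace Ω']
    [NormedAddCommGroup E] (P : Measure Ω) [IsFiniteMeasure P] (X : ℕ → Ω → ℝ) (m : ℕ → ℕ)
    (Xs : ∀ n, Fin (m n) → Ω → ℝ) (Y : ∀ n, (Fin n → ℝ) → (Fin (m n) → ℝ) → E)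
    (Q : Measure Ω') (Z : Ω' → E) : Prop :=
  TendstoInMeasure P (fun n ω => condDBL P (sample X n) (bootSample (Xs n)) (Y n) Q Z ω) atTop
    (fun _ => 0)

/-- Conditionally on the sample, `Y n (sample) (bootstrap sample)` converges weakly to `Z`,
almost surely. -/
def CondWeakAS {Ω Ω' E : Type*} [MeasurableSpace Ω] [MeasurableSpace Ω']
    [NormedAddCommGroup E] (P : Measure Ω) [IsFiniteMeasure P] (X : ℕ → Ω → ℝ) (m : ℕ → ℕ)
    (Xs : ∀ n, Fin (m n) → Ω → ℝ) (Y : ∀ n, (Fin n → ℝ) → (Fin (m n) → ℝ) → E)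
    (Q : Measure Ω') (Z : Ω' → E) : Prop :=
  ∀ᵐ ω ∂P, Tendsto (fun n => condDBL P (sample X n) (bootSample (Xs n)) (Y n) Q Z ω) atTop (𝓝 0)

/-! ### Uniform continuity for a semimetric -/

/-- `z` is uniformly continuous for the semimetric `ρ`. -/
def UnifContFor {ι : Type*} (ρ : ι → ι → ℝ) (z : ι → ℝ) : Prop :=
  ∀ ε > 0, ∃ δ > 0, ∀ s t, ρ s t < δ → |z s - z t| < ε

/-- The `L_1(F)` semimetric `∫ |f - g| dF` on a class of functions, for the distribution `ν`. -/
def distL1 (ν : Measure ℝ) {𝒢 : Set (ℝ → ℝ)} (f g : 𝒢) : ℝ :=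
  ∫ x, |f.1 x - g.1 x| ∂ν

end

/-!
For a right-continuous integrator `z` of bounded variation and `g` in `BVright T`, the integral
`∫ g dz` is the limit of Riemann-Stieltjes sums over a fixed sequence of grids
(`tendsto_riemannSum`). Summation by parts bounds these sums by `3 T sup |z|`, whatever the
variation of `z` (`abs_riemannSum_le`). Hence `z ↦ {∫ g dz, g ∈ 𝒢}` is a Lipschitz map on the
right-continuous functions of bounded variation, with respect to the supremum norms, and extends to
a Lipschitz map `Φ : ℓ^∞(ℝ) → ℓ^∞(𝒢)` (`exists_isIntegralExtension`). The paths of the empirical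
and bootstrap processes are right-continuous of bounded variation, so `Φ` maps them to the integral
processes. All three convergences are therefore instances of the continuous mapping theorem, with
limit `Φ ∘ Z`; for the conditional statements the point is that a map with Lipschitz constant
`K ≥ 1` increases the bounded Lipschitz distance by at most the factor `K` (`dBL_comp_le`).

It remains to see that `Φ ∘ Z` has the required properties. The first two use that a bounded function
which is uniformly continuous for `|F s - F t|` is a uniform limit of functions `w` that are
Lipschitz for it (`exists_lipschitz_approx`), and that these `w` are right-continuous of bounded
variation.

* For such `w` with Lipschitz constant `L`, comparison of Riemann sums gives
  `|∫ f dw - ∫ g dw| ≤ L ∫ |f - g| dF`. As `Φ z` is uniformly close to `Φ w` when `z` is close to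
  `w`, the paths of `Φ ∘ Z` are almost surely uniformly continuous for the `L_1(F)` distance
  (`IsIntegralExtension.unifContFor`).
* The Riemann sums converge to `Φ z` on the closure of the right-continuous functions of bounded
  variation, so almost surely `Φ (Z ω) g` is the limit of linear combinations of values of `Z ω`.
  Almost sure limits of Gaussian processes are Gaussian (`isGaussianProcess_of_tendsto_ae`).
* `Z`, hence `Φ ∘ Z`, is strongly measurable because its paths are uniformly approximated by finite
  combinations of fixed indicators (`aestronglyMeasurable_of_unifContFor`).
-/

/-! ### Limits of Gaussian processes -/

/-- An almost sure limit of real Gaussian variables is Gaussian. Means and variances are bounded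
along a subsequence (else, after normalization, the variables would tend to `0` while their
characteristic functions at `1` stay away from `1`), and they converge along a further one. -/
theorem Real.hasGaussianLaw_of_tendsto_ae {Ω : Type*} [MeasurableSpace Ω] {P : Measure Ω}
    {X : ℕ → Ω → ℝ} {Y : Ω → ℝ} (hX : ∀ n, HasGaussianLaw (X n) P)
    (hlim : ∀ᵐ ω ∂P, Tendsto (fun n => X n ω) atTop (𝓝 (Y ω))) : HasGaussianLaw Y P := by
  have hP : IsProbabilityMeasure P := (hX 0).isProbabilityMeasure
  have hYm : AEMeasurable Y P := aemeasurable_of_tendsto_metrizable_ae atTop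
    (fun n => (hX n).aemeasurable) hlim
  set m : ℕ → ℝ := fun n => ∫ ω, X n ω ∂P with hm
  set s : ℕ → ℝ := fun n => √(Var[X n; P]) with hs
  have hs0 : ∀ n, 0 ≤ s n := fun n => Real.sqrt_nonneg _
  have hchar : ∀ n (t : ℝ), ∫ ω, Complex.exp (t * X n ω * Complex.I) ∂P =
      Complex.exp (t * m n * Complex.I - (s n : ℂ) ^ 2 * t ^ 2 / 2) := by
    intro n t
    have h1 := charFun_gaussianReal (μ := m n) (v := Var[X n; P].toNNReal) t
    rw [← (hX n).map_eq_gaussianReal, charFun_apply_real,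
      integral_map (hX n).aemeasurable (by fun_prop)] at h1
    rw [h1, Real.coe_toNNReal _ (variance_nonneg _ _)]
    congr 4
    rw [hs, ← Complex.ofReal_pow, Real.sq_sqrt (variance_nonneg _ _)]
  have hdom : ∀ (a : ℕ → ℝ) (W : Ω → ℝ) (φ : ℕ → ℕ),
      (∀ᵐ ω ∂P, Tendsto (fun n => a n * X (φ n) ω) atTop (𝓝 (W ω))) →
      Tendsto (fun n => ∫ ω, Complex.exp ((a n : ℝ) * X (φ n) ω * Complex.I) ∂P) atTop
        (𝓝 (∫ ω, Complex.exp (W ω * Complex.I) ∂P)) := by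
    intro a W φ hW
    refine tendsto_integral_of_dominated_convergence (fun _ => 1) (fun n => ?_)
      (integrable_const _) (fun n => ?_) ?_
    · have := (hX (φ n)).aemeasurable
      exact AEMeasurable.aestronglyMeasurable (by fun_prop)
    · refine Eventually.of_forall fun ω => ?_
      rw [← Complex.ofReal_mul, Complex.norm_exp_ofReal_mul_I]
    · filter_upwards [hW] with ω hω
      have hc : Continuous fun x : ℝ => Complex.exp (x * Complex.I) := by fun_prop
      have := (hc.tendsto _).comp hω
      refine this.congr fun n => ?_
      simp
  -- The parameters of the laws stay bounded along a subsequence.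
  have hbdd : ∃ K, ∃ᶠ n in atTop, |m n| + s n ≤ K := by
    by_contra! hcon
    have hb : Tendsto (fun n => |m n| + s n) atTop atTop :=
      tendsto_atTop.2 fun K => by
        filter_upwards [hcon K] with n hn using hn.le
    set b : ℕ → ℝ := fun n => |m n| + s n with hbdef
    -- After division by `b n` the variables tend to `0`, but the laws do not.
    have h0 : Tendsto (fun n => Complex.exp ((((b n)⁻¹ : ℝ) : ℂ) * m n * Complex.I -
        (s n : ℂ) ^ 2 * (((b n)⁻¹ : ℝ) : ℂ) ^ 2 / 2)) atTop (𝓝 1) := by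
      have := hdom (fun n => (b n)⁻¹) (fun _ => 0) id (by
        filter_upwards [hlim] with ω hω
        simpa using (tendsto_inv_atTop_zero.comp hb).mul hω)
      simp only [id, hchar, Complex.ofReal_zero, zero_mul, Complex.exp_zero,
        integral_const, probReal_univ, one_smul] at this
      exact this
    have hform : ∀ n, Complex.exp ((((b n)⁻¹ : ℝ) : ℂ) * m n * Complex.I -
        (s n : ℂ) ^ 2 * (((b n)⁻¹ : ℝ) : ℂ) ^ 2 / 2) =
        (Real.exp (-((b n)⁻¹ * s n) ^ 2 / 2) : ℝ) *
          Complex.exp (((b n)⁻¹ * m n : ℝ) * Complex.I) := by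
      intro n
      rw [Complex.ofReal_exp, ← Complex.exp_add]
      congr 1
      push_cast
      ring
    simp_rw [hform] at h0
    have hmod : Tendsto (fun n => Real.exp (-((b n)⁻¹ * s n) ^ 2 / 2)) atTop (𝓝 1) := by
      simpa [Complex.norm_exp_ofReal_mul_I, -Complex.ofReal_exp, abs_of_pos (Real.exp_pos _),
        -Complex.ofReal_mul] using h0.norm
    have hq : Tendsto (fun n => ((b n)⁻¹ * s n) ^ 2) atTop (𝓝 0) := by
      have := ((Real.continuousAt_log one_ne_zero).tendsto.comp hmod).const_mul (-2)
      simp only [Real.log_one, mul_zero] at this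
      refine this.congr fun n => ?_
      simp only [Function.comp, Real.log_exp]
      ring
    have hq' : Tendsto (fun n => (b n)⁻¹ * s n) atTop (𝓝 0) := by
      have := hq.sqrt
      simp only [Real.sqrt_sq_eq_abs, Real.sqrt_zero] at this
      exact (tendsto_zero_iff_abs_tendsto_zero _).2 this
    have hp : Tendsto (fun n => |(b n)⁻¹ * m n|) atTop (𝓝 1) := by
      have h1 : Tendsto (fun n => 1 - (b n)⁻¹ * s n) atTop (𝓝 1) := by
        simpa using hq'.const_sub 1
      refine h1.congr' ?_
      filter_upwards [hb.eventually_gt_atTop 0] with n hn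
      rw [abs_mul, abs_of_pos (inv_pos.2 hn)]
      have : (b n)⁻¹ * b n = 1 := inv_mul_cancel₀ hn.ne'
      simp only [hbdef] at this ⊢
      linarith
    have hcos : Tendsto (fun n => Real.cos ((b n)⁻¹ * m n)) atTop (𝓝 (Real.cos 1)) := by
      refine ((Real.continuous_cos.tendsto 1).comp hp).congr fun n => ?_
      simp only [Function.comp, Real.cos_abs]
    have hre : Tendsto (fun n => Real.exp (-((b n)⁻¹ * s n) ^ 2 / 2) *
        Real.cos ((b n)⁻¹ * m n)) atTop (𝓝 1) := by
      have := (Complex.continuous_re.tendsto _).comp h0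
      simp only [Complex.one_re] at this
      refine this.congr fun n => ?_
      simp only [Function.comp, Complex.re_ofReal_mul, Complex.exp_ofReal_mul_I_re]
    have := tendsto_nhds_unique hre (hmod.mul hcos)
    have h2 : Real.cos 1 < Real.cos 0 :=
      Real.cos_lt_cos_of_nonneg_of_le_pi le_rfl (by linarith [Real.pi_gt_three]) one_pos
    rw [Real.cos_zero] at h2
    linarith
  obtain ⟨K, hK⟩ := hbdd
  obtain ⟨⟨m₀, s₀⟩, -, φ, hφ, hms⟩ := (isCompact_Icc (a := ((-K, 0) : ℝ × ℝ))
    (b := (K, K))).tendsto_subseq' (x := fun n => (m n, s n)) (hK.mono fun n hn => by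
      have := abs_le.1 (by linarith [hs0 n] : |m n| ≤ K)
      exact ⟨⟨this.1, hs0 n⟩, ⟨this.2, by linarith [abs_nonneg (m n)]⟩⟩)
  have hm₀ : Tendsto (fun n => m (φ n)) atTop (𝓝 m₀) := (continuous_fst.tendsto _).comp hms
  have hs₀ : Tendsto (fun n => s (φ n)) atTop (𝓝 s₀) := (continuous_snd.tendsto _).comp hms
  refine ⟨?_⟩
  have : P.map Y = gaussianReal m₀ (s₀ ^ 2).toNNReal := by
    have := Measure.isProbabilityMeasure_map (μ := P) hYm
    refine Measure.ext_of_charFun (funext fun t => ?_)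
    rw [charFun_gaussianReal, charFun_apply_real, integral_map hYm (by fun_prop),
      Real.coe_toNNReal _ (sq_nonneg _)]
    have h1 := hdom (fun _ => t) (fun ω => t * Y ω) φ (by
      filter_upwards [hlim] with ω hω
      exact (hω.comp hφ.tendsto_atTop).const_mul t)
    simp_rw [hchar] at h1
    have hc : Continuous fun q : ℝ × ℝ =>
      Complex.exp (t * q.1 * Complex.I - (q.2 : ℂ) ^ 2 * t ^ 2 / 2) := by fun_prop
    have h2 := (hc.tendsto (m₀, s₀)).comp (hm₀.prodMk_nhds hs₀)
    simpa using tendsto_nhds_unique h1 h2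
  rw [this]
  infer_instance

theorem isGaussianProcess_of_tendsto_ae {Ω ι : Type*} [MeasurableSpace Ω] {P : Measure Ω}
    {X : ℕ → ι → Ω → ℝ} {Y : ι → Ω → ℝ} (hX : ∀ n, IsGaussianProcess (X n) P)
    (hlim : ∀ i, ∀ᵐ ω ∂P, Tendsto (fun n => X n i ω) atTop (𝓝 (Y i ω))) :
    IsGaussianProcess Y P := by
  refine ⟨fun I => ⟨?_⟩⟩
  have hYm : AEMeasurable (fun ω => I.restrict (Y · ω)) P :=
    aemeasurable_pi_lambda _ fun i => aemeasurable_of_tendsto_metrizable_ae atTop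
      (fun n => (hX n).aemeasurable i) (hlim i)
  refine isGaussian_of_isGaussian_map fun L => ?_
  rw [AEMeasurable.map_map_of_aemeasurable (by fun_prop) hYm]
  refine (Real.hasGaussianLaw_of_tendsto_ae
    (X := fun n ω => L (I.restrict (X n · ω))) (fun n => ?_) ?_).isGaussian_map
  · exact ((hX n).hasGaussianLaw I).map_fun L
  · have : ∀ᵐ ω ∂P, ∀ i : I, Tendsto (fun n => X n i ω) atTop (𝓝 (Y i ω)) :=
      ae_all_iff.2 fun i => hlim i
    filter_upwards [this] with ω hω
    exact (L.continuous.tendsto _).comp (tendsto_pi_nhds.2 hω)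

/-! ### Riemann-Stieltjes sums -/

/-- The points `k / (n + 1) - n`, which for `k ≤ 2 n (n + 1)` divide `[-n, n]` into intervals of
length `1 / (n + 1)`. -/
noncomputable def gridPoint (n k : ℕ) : ℝ := (k : ℝ) / (n + 1) - n

/-- The Riemann-Stieltjes sum of `g` with respect to `z` over the grid `gridPoint n`, with `g`
evaluated at the right end of each interval. -/
noncomputable def riemannSum (n : ℕ) (g z : ℝ → ℝ) : ℝ :=
  ∑ k ∈ Finset.range (2 * n * (n + 1)),
    g (gridPoint n (k + 1)) * (z (gridPoint n (k + 1)) - z (gridPoint n k))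

/-- The step function that on each interval `(a, b]` of the grid `gridPoint n` has the value
`g b`, and vanishes outside of `(-n, n]`. -/
noncomputable def gridStep (n : ℕ) (g : ℝ → ℝ) (x : ℝ) : ℝ :=
  ∑ k ∈ Finset.range (2 * n * (n + 1)),
    indicator (Ioc (gridPoint n k) (gridPoint n (k + 1))) (fun _ => g (gridPoint n (k + 1))) x

theorem gridPoint_mono (n : ℕ) : Monotone (gridPoint n) := fun i j h => by
  have : (i : ℝ) ≤ j := by exact_mod_cast h
  unfold gridPoint
  gcongr

theorem gridPoint_succ_sub (n k : ℕ) : gridPoint n (k + 1) - gridPoint n k = 1 / ((n : ℝ) + 1) := by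
  unfold gridPoint
  push_cast
  ring

theorem gridStep_of_mem {n k : ℕ} (hk : k < 2 * n * (n + 1)) (g : ℝ → ℝ) {x : ℝ}
    (hx : x ∈ Ioc (gridPoint n k) (gridPoint n (k + 1))) :
    gridStep n g x = g (gridPoint n (k + 1)) := by
  unfold gridStep
  rw [Finset.sum_eq_single_of_mem k (Finset.mem_range.2 hk), indicator_of_mem hx]
  intro j _ hjk
  exact indicator_of_notMem (fun hxj => Set.disjoint_left.1
    ((gridPoint_mono n).pairwise_disjoint_on_Ioc_succ hjk) hxj hx) _

theorem abs_gridStep_le {g : ℝ → ℝ} {C : ℝ} (hC : ∀ x, |g x| ≤ C) (n : ℕ) (x : ℝ) :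
    |gridStep n g x| ≤ C := by
  by_cases h : ∃ k < 2 * n * (n + 1), x ∈ Ioc (gridPoint n k) (gridPoint n (k + 1))
  · obtain ⟨k, hk, hx⟩ := h
    rw [gridStep_of_mem hk g hx]
    exact hC _
  · push Not at h
    unfold gridStep
    rw [Finset.sum_eq_zero fun k hk => indicator_of_notMem (h k (Finset.mem_range.1 hk)) _, abs_zero]
    exact (abs_nonneg _).trans (hC 0)

theorem measurable_gridStep (n : ℕ) (g : ℝ → ℝ) : Measurable (gridStep n g) :=
  Finset.measurable_sum _ fun _ _ => measurable_const.indicator measurableSet_Ioc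

theorem tendsto_gridStep {g : ℝ → ℝ} {x : ℝ} (hg : ContinuousWithinAt g (Ici x) x) :
    Tendsto (fun n => gridStep n g x) atTop (𝓝 (g x)) := by
  -- Once `-n < x ≤ n`, the value is `g y` for a point `y ∈ [x, x + 1 / (n + 1)]` of the grid.
  have key : ∀ᶠ n : ℕ in atTop, ∃ y, gridStep n g x = g y ∧ x ≤ y ∧ y ≤ x + 1 / ((n : ℝ) + 1) := by
    filter_upwards [tendsto_natCast_atTop_atTop.eventually_gt_atTop |x|] with n hn
    have hn' := abs_lt.1 hn
    have h0 : gridPoint n 0 < x := by unfold gridPoint; simp; linarith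
    have h1 : x ≤ gridPoint n (2 * n * (n + 1)) := by
      have : gridPoint n (2 * n * (n + 1)) = n := by
        unfold gridPoint
        push_cast
        field_simp
        ring
      linarith
    have hmem : x ∈ ⋃ k ∈ Ico 0 (2 * n * (n + 1)), Ioc (gridPoint n k) (gridPoint n (k + 1)) := by
      have := (gridPoint_mono n).biUnion_Ico_Ioc_map_succ 0 (2 * n * (n + 1))
      simp only [Order.succ_eq_add_one] at this
      rw [this]
      exact ⟨h0, h1⟩
    simp only [mem_iUnion] at hmem
    obtain ⟨k, hk, hx⟩ := hmem
    refine ⟨gridPoint n (k + 1), gridStep_of_mem hk.2 g hx, hx.2, ?_⟩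
    linarith [gridPoint_succ_sub n k, hx.1]
  rw [Metric.tendsto_atTop']
  rw [Metric.continuousWithinAt_iff] at hg
  intro ε hε
  obtain ⟨δ, hδ, hg⟩ := hg ε hε
  obtain ⟨N, hN⟩ := eventually_atTop.1
    (key.and ((tendsto_one_div_add_atTop_nhds_zero_nat (𝕜 := ℝ)).eventually_lt_const hδ))
  refine ⟨N, fun n hn => ?_⟩
  obtain ⟨⟨y, hy, hxy, hyx⟩, hδn⟩ := hN n hn.le
  rw [hy]
  refine hg hxy ?_
  rw [Real.dist_eq, abs_of_nonneg (by linarith)]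
  linarith

theorem isFiniteMeasure_variation {z : ℝ → ℝ} (hz : BoundedVariationOn z univ) :
    IsFiniteMeasure hz.vectorMeasure.variation := by
  rw [← SignedMeasure.totalVariation_eq_variation]
  unfold SignedMeasure.totalVariation
  infer_instance

theorem lsIntegral_gridStep (n : ℕ) (g : ℝ → ℝ) {z : ℝ → ℝ} (hz : BoundedVariationOn z univ)
    (hzc : ∀ x, ContinuousWithinAt z (Ici x) x) :
    lsIntegral (gridStep n g) z hz = riemannSum n g z := by
  have := isFiniteMeasure_variation hz
  unfold lsIntegral gridStep riemannSum
  rw [VectorMeasure.integral_finsetSum]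
  · refine Finset.sum_congr rfl fun k _ => ?_
    rw [VectorMeasure.integral_indicator_const _ measurableSet_Ioc,
      hz.vectorMeasure_Ioc (gridPoint_mono n k.le_succ), (hzc _).rightLim_eq, (hzc _).rightLim_eq]
    simp
  · intro k _
    exact (integrable_const _).indicator measurableSet_Ioc

/-- The Riemann-Stieltjes sums of a bounded right-continuous function converge to its
Lebesgue-Stieltjes integral. -/
theorem tendsto_riemannSum {g : ℝ → ℝ} {C : ℝ} (hC : ∀ x, |g x| ≤ C)
    (hg : ∀ x, ContinuousWithinAt g (Ici x) x) {z : ℝ → ℝ} (hz : BoundedVariationOn z univ)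
    (hzc : ∀ x, ContinuousWithinAt z (Ici x) x) :
    Tendsto (fun n => riemannSum n g z) atTop (𝓝 (lsIntegral g z hz)) := by
  have := isFiniteMeasure_variation hz
  simp_rw [← lsIntegral_gridStep _ g hz hzc]
  exact VectorMeasure.tendsto_integral_of_dominated_convergence (fun _ => C)
    (fun n => (measurable_gridStep n g).aestronglyMeasurable) (integrable_const _)
    (fun n => Eventually.of_forall (abs_gridStep_le hC n))
    (Eventually.of_forall fun x => tendsto_gridStep (hg x))

/-- The integrator is `cdf ν` and the limit is stated with the measure `ν` itself. -/
theorem tendsto_riemannSum_cdf (ν : Measure ℝ) [IsProbabilityMeasure ν] {g : ℝ → ℝ} {C : ℝ}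
    (hC : ∀ x, |g x| ≤ C) (hg : ∀ x, ContinuousWithinAt g (Ici x) x) :
    Tendsto (fun n => riemannSum n g (cdf ν)) atTop (𝓝 (∫ x, g x ∂ν)) := by
  have key : ∀ n, riemannSum n g (cdf ν) = ∫ x, gridStep n g x ∂ν := by
    intro n
    unfold gridStep riemannSum
    rw [integral_finsetSum _ fun k _ => (integrable_const _).indicator measurableSet_Ioc]
    refine Finset.sum_congr rfl fun k _ => ?_
    rw [integral_indicator_const _ measurableSet_Ioc]
    have hle := gridPoint_mono n k.le_succ
    have : ν.real (Ioc (gridPoint n k) (gridPoint n (k + 1))) =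
        cdf ν (gridPoint n (k + 1)) - cdf ν (gridPoint n k) := by
      rw [cdf_eq_real, cdf_eq_real, ← Iic_sdiff_Iic, measureReal_sdiff (Iic_subset_Iic.2 hle)
        measurableSet_Iic]
    rw [this, smul_eq_mul, mul_comm]
  simp_rw [key]
  exact tendsto_integral_of_dominated_convergence (fun _ => C)
    (fun n => (measurable_gridStep n g).aestronglyMeasurable) (integrable_const _)
    (fun n => Eventually.of_forall (abs_gridStep_le hC n))
    (Eventually.of_forall fun x => tendsto_gridStep (hg x))

theorem riemannSum_sub_right (n : ℕ) (g z w : ℝ → ℝ) :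
    riemannSum n g (fun t => z t - w t) = riemannSum n g z - riemannSum n g w := by
  unfold riemannSum
  rw [← Finset.sum_sub_distrib]
  exact Finset.sum_congr rfl fun k _ => by ring

theorem riemannSum_sub_left (n : ℕ) (f g z : ℝ → ℝ) :
    riemannSum n (fun x => f x - g x) z = riemannSum n f z - riemannSum n g z := by
  unfold riemannSum
  rw [← Finset.sum_sub_distrib]
  exact Finset.sum_congr rfl fun k _ => by ring

/-- Summation by parts. -/
theorem sum_mul_sub_eq (a b : ℕ → ℝ) (M : ℕ) :
    ∑ k ∈ Finset.range M, a (k + 1) * (b (k + 1) - b k) =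
      a M * b M - a 0 * b 0 - ∑ k ∈ Finset.range M, b k * (a (k + 1) - a k) := by
  induction M with
  | zero => simp
  | succ M ih =>
    rw [Finset.sum_range_succ, Finset.sum_range_succ, ih]
    ring

/-- Summation by parts bounds the Riemann-Stieltjes sums by the variation of `g`, uniformly over
the grids, whatever the variation of `z`. Two of the three terms `T C` come from the ends of the
grid, so that `z` need not vanish at infinity. -/
theorem abs_riemannSum_le {T : ℝ} (hT : 0 ≤ T) {g : ℝ → ℝ} (hg : g ∈ BVright T) {z : ℝ → ℝ}
    {C : ℝ} (hz : ∀ x, |z x| ≤ C) (n : ℕ) : |riemannSum n g z| ≤ 3 * T * C := by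
  have hC : 0 ≤ C := (abs_nonneg _).trans (hz 0)
  obtain ⟨hvar, hsup, -⟩ := hg
  have hsum : ∑ k ∈ Finset.range (2 * n * (n + 1)),
      |g (gridPoint n (k + 1)) - g (gridPoint n k)| ≤ T := by
    have h := (eVariationOn.sum_le (f := g) (s := univ) (n := 2 * n * (n + 1)) (gridPoint_mono n)
      fun i => mem_univ _).trans hvar
    simp_rw [edist_dist, Real.dist_eq] at h
    rw [← ENNReal.ofReal_sum_of_nonneg fun _ _ => abs_nonneg _] at h
    exact (ENNReal.ofReal_le_ofReal_iff hT).1 h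
  unfold riemannSum
  rw [sum_mul_sub_eq (fun k => g (gridPoint n k)) (fun k => z (gridPoint n k))]
  have h1 : ∀ k, |g (gridPoint n k) * z (gridPoint n k)| ≤ T * C := fun k => by
    rw [abs_mul]
    exact mul_le_mul (hsup _) (hz _) (abs_nonneg _) hT
  have h2 : |∑ k ∈ Finset.range (2 * n * (n + 1)),
      z (gridPoint n k) * (g (gridPoint n (k + 1)) - g (gridPoint n k))| ≤ C * T := by
    refine (Finset.abs_sum_le_sum_abs _ _).trans (le_trans (Finset.sum_le_sum fun k _ => ?_)
      ((Finset.mul_sum _ _ _).symm.le.trans (mul_le_mul_of_nonneg_left hsum hC)))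
    rw [abs_mul]
    exact mul_le_mul_of_nonneg_right (hz _) (abs_nonneg _)
  have h3 := abs_le.1 (h1 (2 * n * (n + 1)))
  have h4 := abs_le.1 (h1 0)
  have h5 := abs_le.1 h2
  rw [abs_le]
  constructor <;> linarith [h3.1, h3.2, h4.1, h4.2, h5.1, h5.2]

theorem abs_riemannSum_le_of_lipschitz {z F : ℝ → ℝ} {L : ℝ} (hF : Monotone F)
    (hz : ∀ s t, |z s - z t| ≤ L * |F s - F t|) (n : ℕ) (g : ℝ → ℝ) :
    |riemannSum n g z| ≤ L * riemannSum n (fun x => |g x|) F := by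
  unfold riemannSum
  rw [Finset.mul_sum]
  refine (Finset.abs_sum_le_sum_abs _ _).trans (Finset.sum_le_sum fun k _ => ?_)
  rw [abs_mul]
  have h := hz (gridPoint n (k + 1)) (gridPoint n k)
  rw [abs_of_nonneg (sub_nonneg.2 (hF (gridPoint_mono n k.le_succ)))] at h
  calc _ ≤ |g (gridPoint n (k + 1))| * (L * (F (gridPoint n (k + 1)) - F (gridPoint n k))) :=
        mul_le_mul_of_nonneg_left h (abs_nonneg _)
    _ = _ := by ring

/-! ### The Lipschitz extension of the integral -/

theorem Linf.abs_apply_le_norm {ι : Type*} (z : Linf ι) (i : ι) : |z i| ≤ ‖z‖ :=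
  lp.norm_apply_le_norm ENNReal.top_ne_zero z i

theorem Linf.abs_sub_apply_le {ι : Type*} (z w : Linf ι) (i : ι) : |z i - w i| ≤ ‖z - w‖ :=
  Linf.abs_apply_le_norm (z - w) i

/-- The right-continuous functions of bounded variation, as a subset of `ℓ^∞(ℝ)`. -/
def rightContBV : Set (Linf ℝ) :=
  {z | BoundedVariationOn z univ ∧ ∀ x, ContinuousWithinAt z (Ici x) x}

/-- `Φ` is a continuous extension to all of `ℓ^∞(ℝ)` of the map that takes a right-continuous
function `z` of bounded variation to the process `{∫ g dz, g ∈ 𝒢}`. The Lipschitz constant `3 T`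
comes from summation by parts. -/
structure IsIntegralExtension {T : ℝ} {𝒢 : Set (ℝ → ℝ)} (h𝒢 : 𝒢 ⊆ BVright T)
    (Φ : Linf ℝ → Linf 𝒢) : Prop where
  norm_sub_le : ∀ z w, ‖Φ z - Φ w‖ ≤ 3 * T * ‖z - w‖
  apply_path : ∀ (z : ℝ → ℝ) (hz : BoundedVariationOn z univ),
    (∀ x, ContinuousWithinAt z (Ici x) x) → Φ (pathInLinf z hz) = integralProcess h𝒢 z hz

section Extension

variable {T : ℝ} {𝒢 : Set (ℝ → ℝ)} {h𝒢 : 𝒢 ⊆ BVright T}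

theorem exists_isIntegralExtension (hT : 0 ≤ T) (h𝒢 : 𝒢 ⊆ BVright T) :
    ∃ Φ, IsIntegralExtension h𝒢 Φ := by
  classical
  let f : Linf ℝ → Linf 𝒢 := fun z =>
    if h : BoundedVariationOn z univ then integralProcess h𝒢 z h else 0
  have hf : LipschitzOnWith (3 * T).toNNReal f rightContBV := by
    refine LipschitzOnWith.of_dist_le_mul fun z hz w hw => ?_
    rw [Real.coe_toNNReal _ (by positivity), dist_eq_norm, dist_eq_norm]
    simp only [f, dif_pos hz.1, dif_pos hw.1]
    refine lp.norm_le_of_forall_le (by positivity) fun g => ?_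
    have h1 := tendsto_riemannSum (h𝒢 g.2).2.1 (h𝒢 g.2).2.2 hz.1 hz.2
    have h2 := tendsto_riemannSum (h𝒢 g.2).2.1 (h𝒢 g.2).2.2 hw.1 hw.2
    refine le_of_tendsto (h1.sub h2).abs (Eventually.of_forall fun n => ?_)
    rw [← riemannSum_sub_right]
    exact abs_riemannSum_le hT (h𝒢 g.2) (Linf.abs_sub_apply_le z w) n
  obtain ⟨Φ, hΦ, hΦf⟩ := hf.extend_lp_infty
  refine ⟨Φ, fun z w => ?_, fun z hz hzc => ?_⟩
  · have := hΦ.dist_le_mul z w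
    rwa [Real.coe_toNNReal _ (by positivity), dist_eq_norm, dist_eq_norm] at this
  · rw [← hΦf (show pathInLinf z hz ∈ rightContBV from ⟨hz, hzc⟩)]
    exact dif_pos hz

namespace IsIntegralExtension

variable {Φ : Linf ℝ → Linf 𝒢}

theorem continuous (hΦ : IsIntegralExtension h𝒢 Φ) : Continuous Φ :=
  (LipschitzWith.of_dist_le' (K := 3 * T) fun z w => by
    rw [dist_eq_norm, dist_eq_norm]
    exact hΦ.norm_sub_le z w).continuous

theorem abs_sub_le (hΦ : IsIntegralExtension h𝒢 Φ) (z w : Linf ℝ) (g : 𝒢) :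
    |Φ z g - Φ w g| ≤ 3 * T * ‖z - w‖ :=
  (Linf.abs_sub_apply_le _ _ g).trans (hΦ.norm_sub_le z w)

theorem tendsto_riemannSum_of_mem (hΦ : IsIntegralExtension h𝒢 Φ) {z : Linf ℝ}
    (hz : z ∈ rightContBV) (g : 𝒢) :
    Tendsto (fun n => riemannSum n g.1 z) atTop (𝓝 (Φ z g)) := by
  have h : Φ z = integralProcess h𝒢 z hz.1 := hΦ.apply_path z hz.1 hz.2
  rw [h]
  exact tendsto_riemannSum (h𝒢 g.2).2.1 (h𝒢 g.2).2.2 hz.1 hz.2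

/-- On the closure of the right-continuous functions of bounded variation, `Φ` is a pointwise
limit of linear combinations of evaluations. -/
theorem tendsto_riemannSum_of_mem_closure (hΦ : IsIntegralExtension h𝒢 Φ) (hT : 0 < T)
    {z : Linf ℝ} (hz : z ∈ closure rightContBV) (g : 𝒢) :
    Tendsto (fun n => riemannSum n g.1 z) atTop (𝓝 (Φ z g)) := by
  rw [Metric.tendsto_atTop]
  intro ε hε
  obtain ⟨w, hw, hzw⟩ := Metric.mem_closure_iff.1 hz (ε / (9 * T)) (by positivity)
  rw [dist_eq_norm, lt_div_iff₀ (by positivity)] at hzw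
  obtain ⟨N, hN⟩ := Metric.tendsto_atTop.1 (hΦ.tendsto_riemannSum_of_mem hw g) (ε / 3)
    (by positivity)
  refine ⟨N, fun n hn => ?_⟩
  have h1 := hN n hn
  have h2 := hΦ.abs_sub_le z w g
  have h3 := abs_riemannSum_le hT.le (h𝒢 g.2) (Linf.abs_sub_apply_le z w) n
  rw [riemannSum_sub_right] at h3
  rw [Real.dist_eq] at h1 ⊢
  rw [abs_lt] at h1 ⊢
  have h2 := abs_le.1 h2
  have h3 := abs_le.1 h3
  constructor <;> linarith [h1.1, h1.2, h2.1, h2.2, h3.1, h3.2]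

end IsIntegralExtension

/-! ### Approximation by functions that are Lipschitz in `F` -/

theorem mem_rightContBV_of_lipschitz {F : ℝ → ℝ} (hF : Monotone F) {B : ℝ}
    (hB : ∀ x, |F x| ≤ B) (hFc : ∀ x, ContinuousWithinAt F (Ici x) x) {L : ℝ} (hL : 0 ≤ L)
    {w : Linf ℝ} (hw : ∀ s t, |w s - w t| ≤ L * |F s - F t|) : w ∈ rightContBV := by
  constructor
  · -- `w` is the difference of the monotone functions `w + L F` and `L F`.
    have ha : Monotone fun t => w t + L * F t := fun s t hst => by
      have h := hw t s
      rw [abs_of_nonneg (sub_nonneg.2 (hF hst))] at h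
      have := (abs_le.1 h).1
      simp only
      linarith
    have hb : ∀ t, |L * F t| ≤ L * B := fun t => by
      rw [abs_mul, abs_of_nonneg hL]
      exact mul_le_mul_of_nonneg_left (hB t) hL
    have h := bv_sub_of_monotone ha (hF.const_mul hL) (A := ‖w‖ + L * B)
      (fun t => (abs_add_le _ _).trans (add_le_add (Linf.abs_apply_le_norm w t) (hb t))) hb
    simpa using h
  · intro x
    rw [ContinuousWithinAt, tendsto_iff_dist_tendsto_zero]
    have h : Tendsto (fun t => L * |F t - F x|) (𝓝[Ici x] x) (𝓝 0) := by
      simpa using ((hFc x).tendsto.sub_const (F x)).abs.const_mul L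
    exact squeeze_zero (fun _ => dist_nonneg) (fun t => hw t x) h

/-- A bounded function that is uniformly continuous for `|F s - F t|` is a uniform limit of
functions that are Lipschitz for it, namely the infimal convolutions
`t ↦ inf_s (z s + L |F s - F t|)`. -/
theorem exists_lipschitz_approx {F : ℝ → ℝ} {z : Linf ℝ}
    (hz : UnifContFor (fun s t => |F s - F t|) z) {ε : ℝ} (hε : 0 < ε) :
    ∃ L, 0 ≤ L ∧ ∃ w : Linf ℝ, ‖z - w‖ ≤ ε ∧ ∀ s t, |w s - w t| ≤ L * |F s - F t| := by
  obtain ⟨δ, hδ, hzδ⟩ := hz ε hε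
  set L := 2 * ‖z‖ / δ with hLdef
  have hL : 0 ≤ L := by positivity
  set u : ℝ → ℝ := fun t => ⨅ s, (z s + L * |F s - F t|) with hu
  have hbdd : ∀ t, BddBelow (range fun s => z s + L * |F s - F t|) := fun t => by
    refine ⟨-‖z‖, ?_⟩
    rintro _ ⟨s, rfl⟩
    have := (abs_le.1 (Linf.abs_apply_le_norm z s)).1
    have : 0 ≤ L * |F s - F t| := by positivity
    simp only
    linarith
  have hle : ∀ t, u t ≤ z t := fun t => by
    have := ciInf_le (hbdd t) t
    simpa using this
  have hge : ∀ t, z t - ε ≤ u t := fun t => le_ciInf fun s => by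
    by_cases h : |F s - F t| < δ
    · have := (abs_lt.1 (hzδ s t h)).1
      have : 0 ≤ L * |F s - F t| := by positivity
      linarith
    · have h1 := (abs_le.1 (Linf.abs_apply_le_norm z s)).1
      have h2 := (abs_le.1 (Linf.abs_apply_le_norm z t)).2
      have h3 : 2 * ‖z‖ ≤ L * |F s - F t| := by
        calc 2 * ‖z‖ = L * δ := by rw [hLdef]; field_simp
          _ ≤ _ := mul_le_mul_of_nonneg_left (not_lt.1 h) hL
      linarith
  have hzu : ∀ t, |z t - u t| ≤ ε := fun t => abs_le.2 ⟨by linarith [hle t], by linarith [hge t]⟩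
  have hmem : Memℓp (E := fun _ : ℝ => ℝ) u ⊤ := by
    refine memℓp_infty ⟨‖z‖ + ε, ?_⟩
    rintro _ ⟨t, rfl⟩
    have h1 := abs_le.1 (Linf.abs_apply_le_norm z t)
    have h2 := abs_le.1 (hzu t)
    exact abs_le.2 ⟨by linarith [h1.1, h2.2], by linarith [h1.2, h2.1]⟩
  have hlip : ∀ s t, u s - u t ≤ L * |F s - F t| := fun s t => by
    have : u s - L * |F s - F t| ≤ u t := le_ciInf fun r => by
      have h1 : u s ≤ z r + L * |F r - F s| := ciInf_le (hbdd s) r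
      have h2 : L * |F r - F s| ≤ L * (|F r - F t| + |F s - F t|) := by
        refine mul_le_mul_of_nonneg_left ?_ hL
        rw [abs_sub_comm (F s)]
        exact abs_sub_le _ _ _
      linarith
    linarith
  refine ⟨L, hL, ⟨u, hmem⟩, lp.norm_le_of_forall_le hε.le hzu, fun s t => abs_le.2 ⟨?_, hlip s t⟩⟩
  have := hlip t s
  rw [abs_sub_comm] at this
  change -(L * |F s - F t|) ≤ u s - u t
  linarith

theorem continuousWithinAt_cdf (ν : Measure ℝ) (x : ℝ) : ContinuousWithinAt (cdf ν) (Ici x) x :=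
  (cdf ν).right_continuous x

theorem abs_cdf_le_one (ν : Measure ℝ) (x : ℝ) : |cdf ν x| ≤ 1 := by
  rw [abs_of_nonneg (cdf_nonneg ν x)]
  exact cdf_le_one ν x

theorem mem_closure_rightContBV {ν : Measure ℝ} {z : Linf ℝ}
    (hz : UnifContFor (fun s t => |cdf ν s - cdf ν t|) z) : z ∈ closure rightContBV := by
  rw [Metric.mem_closure_iff]
  intro ε hε
  obtain ⟨L, hL, w, hzw, hw⟩ := exists_lipschitz_approx hz (half_pos hε)
  refine ⟨w, mem_rightContBV_of_lipschitz (monotone_cdf ν) (abs_cdf_le_one ν)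
    (continuousWithinAt_cdf ν) hL hw, ?_⟩
  rw [dist_eq_norm]
  linarith

/-- The extended integral of a path that is uniformly continuous for `|F s - F t|` is uniformly
continuous in the integrand for the `L_1(F)` distance: for a path `w` with Lipschitz constant `L`
the difference of the integrals of `f` and `g` is at most `L ∫ |f - g| dF`. -/
theorem IsIntegralExtension.unifContFor {Φ : Linf ℝ → Linf 𝒢} (hΦ : IsIntegralExtension h𝒢 Φ)
    (hT : 0 < T) {ν : Measure ℝ} [IsProbabilityMeasure ν] {z : Linf ℝ}
    (hz : UnifContFor (fun s t => |cdf ν s - cdf ν t|) z) : UnifContFor (distL1 ν) (Φ z) := by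
  intro ε hε
  obtain ⟨L, hL, w, hzw, hw⟩ := exists_lipschitz_approx hz (ε := ε / (9 * T)) (by positivity)
  rw [le_div_iff₀ (by positivity)] at hzw
  have hwV := mem_rightContBV_of_lipschitz (monotone_cdf ν) (abs_cdf_le_one ν)
    (continuousWithinAt_cdf ν) hL hw
  have key : ∀ f g : 𝒢, |Φ w f - Φ w g| ≤ L * distL1 ν f g := fun f g => by
    have h1 := ((hΦ.tendsto_riemannSum_of_mem hwV f).sub (hΦ.tendsto_riemannSum_of_mem hwV g)).abs
    have h2 := (tendsto_riemannSum_cdf ν (g := fun x => |f.1 x - g.1 x|) (C := T + T)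
      (fun x => by
        rw [abs_abs]
        exact (abs_sub _ _).trans (add_le_add ((h𝒢 f.2).2.1 x) ((h𝒢 g.2).2.1 x)))
      (fun x => (((h𝒢 f.2).2.2 x).sub ((h𝒢 g.2).2.2 x)).abs)).const_mul L
    refine le_of_tendsto_of_tendsto' h1 h2 fun n => ?_
    rw [← riemannSum_sub_left]
    exact abs_riemannSum_le_of_lipschitz (monotone_cdf ν) hw n _
  refine ⟨ε / (3 * (L + 1)), by positivity, fun f g hfg => ?_⟩
  rw [lt_div_iff₀ (by positivity)] at hfg
  have h0 : 0 ≤ distL1 ν f g := integral_nonneg fun x => abs_nonneg _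
  have h1 := abs_le.1 (key f g)
  have h2 := abs_le.1 (hΦ.abs_sub_le z w f)
  have h3 := abs_le.1 (hΦ.abs_sub_le z w g)
  exact abs_lt.2 ⟨by linarith [h1.1, h2.1, h3.2], by linarith [h1.2, h2.2, h3.1]⟩

end Extension

/-! ### Measurability of the limit process -/

/-- Measurability of the coordinates suffices, since the range of `F` is totally bounded. -/
theorem aestronglyMeasurable_of_unifContFor {Ω' : Type*} [MeasurableSpace Ω'] {Q : Measure Ω'}
    {Z : Ω' → Linf ℝ} (hZm : ∀ t, AEMeasurable (fun ω => Z ω t) Q) {F : ℝ → ℝ}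
    (hF : ∀ x, F x ∈ Icc (0 : ℝ) 1)
    (hZ : ∀ᵐ ω ∂Q, UnifContFor (fun s t => |F s - F t|) (Z ω)) : AEStronglyMeasurable Z Q := by
  classical
  -- The cells `{t | ⌊(n + 1) F t⌋ = k}` have diameter at most `1 / (n + 1)`; on each of them the
  -- path is replaced by its value at a chosen point.
  let cell : ℕ → ℕ → Set ℝ := fun n k => {t | ⌊((n : ℝ) + 1) * F t⌋₊ = k}
  let c : ℕ → ℕ → ℝ := fun n k => if h : (cell n k).Nonempty then h.some else 0
  have hmem : ∀ n k, Memℓp (E := fun _ : ℝ => ℝ) (indicator (cell n k) fun _ => (1 : ℝ)) ⊤ := by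
    intro n k
    refine memℓp_infty ⟨1, ?_⟩
    rintro _ ⟨t, rfl⟩
    by_cases h : t ∈ cell n k <;> simp [h]
  let e : ℕ → ℕ → Linf ℝ := fun n k => ⟨indicator (cell n k) fun _ => (1 : ℝ), hmem n k⟩
  let A : ℕ → Ω' → Linf ℝ := fun n ω => ∑ k ∈ Finset.range (n + 2), Z ω (c n k) • e n k
  have hA : ∀ n ω t, ∃ s, A n ω t = Z ω s ∧ |F t - F s| < 1 / ((n : ℝ) + 1) := by
    intro n ω t
    have hn : (0 : ℝ) < (n : ℝ) + 1 := by positivity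
    set k := ⌊((n : ℝ) + 1) * F t⌋₊ with hk
    have hpos : 0 ≤ ((n : ℝ) + 1) * F t := mul_nonneg hn.le (hF t).1
    have hkn : k ∈ Finset.range (n + 2) := by
      rw [Finset.mem_range, hk, Nat.floor_lt hpos]
      push_cast
      nlinarith [(hF t).2]
    have hne : (cell n k).Nonempty := ⟨t, rfl⟩
    have hcs : c n k ∈ cell n k := by
      simp only [c, dif_pos hne]
      exact hne.some_mem
    refine ⟨c n k, ?_, ?_⟩
    · have h1 : A n ω t = ∑ j ∈ Finset.range (n + 2),
          Z ω (c n j) * indicator (cell n j) (fun _ => (1 : ℝ)) t := by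
        simp only [A, lp.coeFn_sum, Finset.sum_apply]
        rfl
      rw [h1, Finset.sum_eq_single_of_mem k hkn]
      · have : t ∈ cell n k := rfl
        simp [this]
      · intro j _ hj
        have : t ∉ cell n j := fun h => hj (Eq.symm h)
        simp [this]
    · have hs : ⌊((n : ℝ) + 1) * F (c n k)⌋₊ = k := hcs
      have h1 := Nat.floor_le hpos
      have h2 := Nat.lt_floor_add_one (((n : ℝ) + 1) * F t)
      have h3 := Nat.floor_le (mul_nonneg hn.le (hF (c n k)).1)
      have h4 := Nat.lt_floor_add_one (((n : ℝ) + 1) * F (c n k))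
      rw [hs] at h3 h4
      rw [← hk] at h1 h2
      rw [lt_div_iff₀ hn, ← abs_of_pos hn, ← abs_mul]
      exact abs_lt.2 ⟨by linarith, by linarith⟩
  refine aestronglyMeasurable_of_tendsto_ae atTop (f := A) (fun n => ?_) ?_
  · exact Finset.aestronglyMeasurable_fun_sum _ fun k _ =>
      (hZm (c n k)).aestronglyMeasurable.smul_const _
  · filter_upwards [hZ] with ω hω
    rw [Metric.tendsto_atTop]
    intro ε hε
    obtain ⟨δ, hδ, h⟩ := hω (ε / 2) (half_pos hε)
    obtain ⟨N, hN⟩ := eventually_atTop.1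
      ((tendsto_one_div_add_atTop_nhds_zero_nat (𝕜 := ℝ)).eventually_lt_const hδ)
    refine ⟨N, fun n hn => lt_of_le_of_lt ?_ (half_lt_self hε)⟩
    rw [dist_eq_norm, norm_sub_rev]
    refine lp.norm_le_of_forall_le (half_pos hε).le fun t => ?_
    obtain ⟨s, hs, hst⟩ := hA n ω t
    change |Z ω t - A n ω t| ≤ ε / 2
    rw [hs]
    exact (h t s (hst.trans (hN n hn))).le

/-! ### Outer expectations and the bounded Lipschitz distance -/

section OuterExpectation

variable {α : Type*} [MeasurableSpace α] {μ : Measure α}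

theorem outerExp_const_mul {c : ℝ} (hc : 0 < c) (f : α → ℝ) :
    outerExp μ (fun a => c * f a) = c * outerExp μ f := by
  unfold outerExp
  rw [← smul_eq_mul, ← Real.sInf_smul_of_nonneg hc.le]
  congr 1
  ext r
  simp only [mem_smul_set, mem_ofPred_eq]
  constructor
  · rintro ⟨u, hu, hui, hfu, rfl⟩
    refine ⟨∫ a, c⁻¹ * u a ∂μ, ⟨fun a => c⁻¹ * u a, hu.const_mul _, hui.const_mul _, fun a => ?_,
      rfl⟩, ?_⟩
    · change f a ≤ c⁻¹ * u a
      rw [inv_mul_eq_div, le_div_iff₀ hc, mul_comm]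
      exact hfu a
    · rw [integral_const_mul, smul_eq_mul, mul_inv_cancel_left₀ hc.ne']
  · rintro ⟨_, ⟨u, hu, hui, hfu, rfl⟩, rfl⟩
    exact ⟨fun a => c * u a, hu.const_mul _, hui.const_mul _,
      fun a => mul_le_mul_of_nonneg_left (hfu a) hc.le, by rw [integral_const_mul, smul_eq_mul]⟩

theorem abs_outerExp_le_one [IsProbabilityMeasure μ] {f : α → ℝ} (hf : ∀ a, |f a| ≤ 1) :
    |outerExp μ f| ≤ 1 := by
  have hlow : ∀ r ∈ {r | ∃ u : α → ℝ, Measurable u ∧ Integrable u μ ∧ (∀ a, f a ≤ u a) ∧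
      r = ∫ a, u a ∂μ}, -1 ≤ r := by
    rintro _ ⟨u, -, hui, hfu, rfl⟩
    have := integral_mono (integrable_const (-1 : ℝ)) hui
      fun a => (abs_le.1 (hf a)).1.trans (hfu a)
    simpa using this
  have hmem : (1 : ℝ) ∈ {r | ∃ u : α → ℝ, Measurable u ∧ Integrable u μ ∧ (∀ a, f a ≤ u a) ∧
      r = ∫ a, u a ∂μ} :=
    ⟨fun _ => 1, measurable_const, integrable_const _, fun a => (abs_le.1 (hf a)).2, by simp⟩
  exact abs_le.2 ⟨le_csInf ⟨1, hmem⟩ hlow, csInf_le ⟨-1, hlow⟩ hmem⟩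

end OuterExpectation

section BoundedLipschitz

variable {α β : Type*} [MeasurableSpace α] [MeasurableSpace β] {μ : Measure α} {Q : Measure β}
  {E E' : Type*} [NormedAddCommGroup E] [NormedAddCommGroup E']

theorem dBL_nonneg (μ : Measure α) (Y : α → E) (Q : Measure β) (Z : β → E) : 0 ≤ dBL μ Y Q Z :=
  Real.iSup_nonneg fun _ => abs_nonneg _

/-- The bounded Lipschitz distance is the supremum of a bounded family, so that it dominates each
of its members. -/
theorem le_dBL [IsProbabilityMeasure μ] [IsProbabilityMeasure Q] (Y : α → E) (Z : β → E)
    {h : E → ℝ} (hh : h ∈ BL1 E) :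
    |outerExp μ (fun a => h (Y a)) - ∫ b, h (Z b) ∂Q| ≤ dBL μ Y Q Z := by
  have hbdd : BddAbove (range fun h : BL1 E =>
      |outerExp μ (fun a => h.1 (Y a)) - ∫ b, h.1 (Z b) ∂Q|) := by
    refine ⟨1 + 1, ?_⟩
    rintro _ ⟨h, rfl⟩
    refine (abs_sub _ _).trans (add_le_add (abs_outerExp_le_one fun a => h.2.1 _) ?_)
    simpa using norm_integral_le_of_norm_le_const (μ := Q) (f := fun b => h.1 (Z b)) (C := 1)
      (Eventually.of_forall fun b => h.2.1 _)
  exact le_ciSup hbdd (⟨h, hh⟩ : BL1 E)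

/-- A map with Lipschitz constant `K ≥ 1` increases the bounded Lipschitz distance by at most the
factor `K`. -/
theorem dBL_comp_le [IsProbabilityMeasure μ] [IsProbabilityMeasure Q] {K : ℝ} (hK : 1 ≤ K)
    {Φ : E → E'} (hΦ : ∀ x y, ‖Φ x - Φ y‖ ≤ K * ‖x - y‖) (Y : α → E) (Z : β → E) :
    dBL μ (fun a => Φ (Y a)) Q (fun b => Φ (Z b)) ≤ K * dBL μ Y Q Z := by
  have hK0 : 0 < K := one_pos.trans_le hK
  refine Real.iSup_le (fun h => ?_) (mul_nonneg hK0.le (dBL_nonneg _ _ _ _))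
  have hmem : (fun x => K⁻¹ * h.1 (Φ x)) ∈ BL1 E := by
    refine ⟨fun x => ?_, fun x y => ?_⟩
    · rw [abs_mul, abs_of_pos (inv_pos.2 hK0)]
      exact mul_le_one₀ (inv_le_one_of_one_le₀ hK) (abs_nonneg _) (h.2.1 _)
    · rw [← mul_sub, abs_mul, abs_of_pos (inv_pos.2 hK0), inv_mul_le_iff₀ hK0]
      exact (h.2.2 _ _).trans (hΦ x y)
  have := mul_le_mul_of_nonneg_left (le_dBL (μ := μ) (Q := Q) Y Z hmem) hK0.le
  rwa [outerExp_const_mul (inv_pos.2 hK0), integral_const_mul, ← mul_sub, abs_mul,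
    abs_of_pos (inv_pos.2 hK0), mul_inv_cancel_left₀ hK0.ne'] at this

theorem dBL_congr_ae (Y : α → E) {Z Z' : β → E} (hZ : Z =ᵐ[Q] Z') : dBL μ Y Q Z = dBL μ Y Q Z' := by
  unfold dBL
  congr 1
  ext h
  congr 2
  exact integral_congr_ae (hZ.mono fun b hb => by simp only [hb])

end BoundedLipschitz

section ConditionalConvergence

variable {Ω Ω' E E' : Type*} [MeasurableSpace Ω] [MeasurableSpace Ω'] [NormedAddCommGroup E]
  [NormedAddCommGroup E'] {P : Measure Ω} [IsFiniteMeasure P] {X : ℕ → Ω → ℝ} {m : ℕ → ℕ}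
  {Xs : ∀ n, Fin (m n) → Ω → ℝ} {Y : ∀ n, (Fin n → ℝ) → (Fin (m n) → ℝ) → E}
  {Q : Measure Ω'} {Z : Ω' → E} {Φ : E → E'} {K : ℝ}

theorem condDBL_comp_le [IsProbabilityMeasure Q] (hK : 1 ≤ K) (hΦ : ∀ x y, ‖Φ x - Φ y‖ ≤ K * ‖x - y‖) (n : ℕ) (ω : Ω) :
    condDBL P (sample X n) (bootSample (Xs n)) (fun x xs => Φ (Y n x xs)) Q (fun b => Φ (Z b)) ω ≤
      K * condDBL P (sample X n) (bootSample (Xs n)) (Y n) Q Z ω :=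
  dBL_comp_le hK hΦ _ _

theorem CondWeakAS.comp [IsProbabilityMeasure Q] (hK : 1 ≤ K) (hΦ : ∀ x y, ‖Φ x - Φ y‖ ≤ K * ‖x - y‖)
    (h : CondWeakAS P X m Xs Y Q Z) :
    CondWeakAS P X m Xs (fun n x xs => Φ (Y n x xs)) Q (fun b => Φ (Z b)) := by
  filter_upwards [h] with ω hω
  refine squeeze_zero (fun n => dBL_nonneg _ _ _ _) (fun n => condDBL_comp_le hK hΦ n ω) ?_
  simpa using hω.const_mul K

theorem CondWeakInProb.comp [IsProbabilityMeasure Q] (hK : 1 ≤ K) (hΦ : ∀ x y, ‖Φ x - Φ y‖ ≤ K * ‖x - y‖)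
    (h : CondWeakInProb P X m Xs Y Q Z) :
    CondWeakInProb P X m Xs (fun n x xs => Φ (Y n x xs)) Q (fun b => Φ (Z b)) := by
  have hK0 : 0 < K := one_pos.trans_le hK
  unfold CondWeakInProb at h ⊢
  rw [tendstoInMeasure_iff_norm] at h ⊢
  intro ε hε
  refine tendsto_of_tendsto_of_tendsto_of_le_of_le tendsto_const_nhds (h (ε / K) (by positivity))
    (fun n => zero_le) fun n => measure_mono fun ω hω => ?_
  simp only [mem_ofPred_eq, sub_zero, Real.norm_eq_abs, condDBL] at hω ⊢
  rw [abs_of_nonneg (dBL_nonneg _ _ _ _)] at hω ⊢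
  rw [div_le_iff₀' hK0]
  exact hω.trans (condDBL_comp_le hK hΦ n ω)

theorem condWeakAS_congr_ae {Z' : Ω' → E} (hZ : Z =ᵐ[Q] Z') (h : CondWeakAS P X m Xs Y Q Z) :
    CondWeakAS P X m Xs Y Q Z' := by
  unfold CondWeakAS condDBL at h ⊢
  simpa only [dBL_congr_ae _ hZ] using h

theorem condWeakInProb_congr_ae {Z' : Ω' → E} (hZ : Z =ᵐ[Q] Z')
    (h : CondWeakInProb P X m Xs Y Q Z) : CondWeakInProb P X m Xs Y Q Z' := by
  unfold CondWeakInProb condDBL at h ⊢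
  simpa only [dBL_congr_ae _ hZ] using h

end ConditionalConvergence

theorem WeakConv.comp {α β E E' : Type*} [MeasurableSpace α] [MeasurableSpace β]
    [TopologicalSpace E] [TopologicalSpace E'] {P : Measure α} {Y : ℕ → α → E} {Q : Measure β}
    {Z : β → E} (h : WeakConv P Y Q Z) {Φ : E → E'} (hΦ : Continuous Φ) {Z' : β → E'}
    (hZ' : (fun b => Φ (Z b)) =ᵐ[Q] Z') : WeakConv P (fun n a => Φ (Y n a)) Q Z' := by
  intro f
  have := h (f.compContinuous ⟨Φ, hΦ⟩)
  rw [integral_congr_ae (hZ'.mono fun b hb => congrArg f hb.symm)]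
  exact this

/-! ### Empirical processes and Riemann sums of the limit process -/

theorem continuousWithinAt_stepAt (x t : ℝ) : ContinuousWithinAt (stepAt x) (Ici t) t := by
  by_cases h : x ≤ t
  · refine continuousWithinAt_const.congr (f := fun _ => (1 : ℝ)) (fun s hs => ?_) ?_
    · simp [stepAt, h.trans hs]
    · simp [stepAt, h]
  · have : stepAt x =ᶠ[𝓝 t] fun _ => (0 : ℝ) := by
      filter_upwards [Iio_mem_nhds (not_le.1 h)] with s hs
      simp [stepAt, mem_Iio.1 hs]
    exact (continuousAt_const.congr this.symm).continuousWithinAt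

theorem continuousWithinAt_bootProcess (n m : ℕ) (x : Fin n → ℝ) (xs : Fin m → ℝ) (t : ℝ) :
    ContinuousWithinAt (bootProcess n m x xs) (Ici t) t := by
  have h : ∀ {k : ℕ} (y : Fin k → ℝ),
      ContinuousWithinAt (fun t => ∑ i, stepAt (y i) t) (Ici t) t := fun y =>
    tendsto_finsetSum _ fun i _ => continuousWithinAt_stepAt (y i) t
  exact ((h xs).const_mul _ |>.sub ((h x).const_mul _)).const_mul _

theorem continuousWithinAt_empProcess (ν : Measure ℝ) (n : ℕ) (x : Fin n → ℝ) (t : ℝ) :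
    ContinuousWithinAt (empProcess (cdf ν) n x) (Ici t) t :=
  ContinuousWithinAt.const_mul (tendsto_finsetSum _ fun i _ =>
    (continuousWithinAt_stepAt (x i) t).sub (continuousWithinAt_cdf ν t)) _

theorem isGaussianProcess_riemannSum {Ω' : Type*} [MeasurableSpace Ω'] {Q : Measure Ω'}
    {Z : Ω' → Linf ℝ} (hZ : IsGaussianProcess (fun t ω => Z ω t) Q) (𝒢 : Set (ℝ → ℝ)) (n : ℕ) :
    IsGaussianProcess (fun (g : 𝒢) ω => riemannSum n g.1 (Z ω)) Q := by
  classical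
  refine hZ.of_isGaussianProcess fun g =>
    ⟨(Finset.range (2 * n * (n + 1) + 1)).image (gridPoint n),
      ∑ k : Fin (2 * n * (n + 1)), g.1 (gridPoint n (k + 1)) •
        (ContinuousLinearMap.proj ⟨gridPoint n (k + 1), Finset.mem_image_of_mem _
            (Finset.mem_range.2 (Nat.succ_lt_succ k.2))⟩ -
          ContinuousLinearMap.proj ⟨gridPoint n k, Finset.mem_image_of_mem _
            (Finset.mem_range.2 (Nat.lt_succ_of_lt k.2))⟩), fun ω => ?_⟩
  simp only [riemannSum, Finset.sum_range, sum_apply, smul_apply, sub_apply,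
    ContinuousLinearMap.proj_apply, Finset.restrict, smul_eq_mul]

/-! ### Convergence of the integral processes -/

theorem theorem6 {Ω Ω' : Type*} [MeasurableSpace Ω] [MeasurableSpace Ω']
    (P : Measure Ω) [IsProbabilityMeasure P] (Q : Measure Ω') [IsProbabilityMeasure Q]
    -- the observations, with common distribution `ν` (and distribution function `F = cdf ν`)
    (ν : Measure ℝ) (X : ℕ → Ω → ℝ) (hX : ∀ i, Measurable (X i)) (hlaw : ∀ i, P.map (X i) = ν)
    -- the bootstrap samples
    (m : ℕ → ℕ) (hm : ∀ n, 0 < m n) (Xs : ∀ n, Fin (m n) → Ω → ℝ)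
    (hXs : ∀ n i, Measurable (Xs n i))
    -- the index class
    (T : ℝ) (hT : 0 < T) (𝒢 : Set (ℝ → ℝ)) (h𝒢 : 𝒢 ⊆ BVright T)
    -- the limit of the bootstrap empirical process
    (Z : Ω' → Linf ℝ) (hZgauss : IsGaussianProcess (fun t ω => Z ω t) Q)
    (hZcont : ∀ᵐ ω ∂Q, UnifContFor (fun s t => |cdf ν s - cdf ν t|) (Z ω))
    (hconv :
      CondWeakInProb P X m Xs
          (fun n x xs => pathInLinf (bootProcess n (m n) x xs) (bv_bootProcess n (m n) x xs)) Q Z ∨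
      CondWeakAS P X m Xs
          (fun n x xs => pathInLinf (bootProcess n (m n) x xs) (bv_bootProcess n (m n) x xs)) Q Z) :
    ∃ Zbar : Ω' → Linf 𝒢,
      IsGaussianProcess (fun g ω => Zbar ω g) Q ∧
      AEStronglyMeasurable Zbar Q ∧
      (∀ ω, UnifContFor (distL1 ν) (Zbar ω)) ∧
      -- convergence in probability
      (CondWeakInProb P X m Xs
          (fun n x xs => pathInLinf (bootProcess n (m n) x xs) (bv_bootProcess n (m n) x xs)) Q Z →
        CondWeakInProb P X m Xs
          (fun n x xs =>
            integralProcess h𝒢 (bootProcess n (m n) x xs) (bv_bootProcess n (m n) x xs)) Q Zbar) ∧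
      -- almost sure convergence
      (CondWeakAS P X m Xs
          (fun n x xs => pathInLinf (bootProcess n (m n) x xs) (bv_bootProcess n (m n) x xs)) Q Z →
        CondWeakAS P X m Xs
          (fun n x xs =>
            integralProcess h𝒢 (bootProcess n (m n) x xs) (bv_bootProcess n (m n) x xs)) Q Zbar) ∧
      -- the same limit for the empirical process and for the bootstrap empirical process
      (WeakConv P
          (fun n ω => pathInLinf (empProcess (cdf ν) n (sample X n ω))
            (bv_empProcess ν n (sample X n ω))) Q Z →
        WeakConv P
          (fun n ω => integralProcess h𝒢 (empProcess (cdf ν) n (sample X n ω))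
            (bv_empProcess ν n (sample X n ω))) Q Zbar) := by
  classical
  have hν : IsProbabilityMeasure ν := by
    rw [← hlaw 0]
    exact Measure.isProbabilityMeasure_map (hX 0).aemeasurable
  obtain ⟨Φ, hΦ⟩ := exists_isIntegralExtension hT.le h𝒢
  have hZm : AEStronglyMeasurable Z Q := aestronglyMeasurable_of_unifContFor
    (fun t => hZgauss.aemeasurable t) (fun x => ⟨cdf_nonneg ν x, cdf_le_one ν x⟩) hZcont
  -- The paths `Φ (Z ω)` are uniformly continuous for almost all `ω`; the others are replaced by `0`.
  let Zbar : Ω' → Linf 𝒢 := fun ω => if UnifContFor (distL1 ν) (Φ (Z ω)) then Φ (Z ω) else 0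
  have hae : (fun ω => Φ (Z ω)) =ᵐ[Q] Zbar := by
    filter_upwards [hZcont] with ω hω
    exact (if_pos (hΦ.unifContFor hT hω)).symm
  set K : ℝ := max 1 (3 * T)
  have hK : 1 ≤ K := le_max_left _ _
  have hlip : ∀ z w, ‖Φ z - Φ w‖ ≤ K * ‖z - w‖ := fun z w =>
    (hΦ.norm_sub_le z w).trans (mul_le_mul_of_nonneg_right (le_max_right _ _) (norm_nonneg _))
  have hboot : ∀ n (x : Fin n → ℝ) (xs : Fin (m n) → ℝ),
      Φ (pathInLinf (bootProcess n (m n) x xs) (bv_bootProcess n (m n) x xs)) =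
        integralProcess h𝒢 (bootProcess n (m n) x xs) (bv_bootProcess n (m n) x xs) :=
    fun n x xs => hΦ.apply_path _ _ (continuousWithinAt_bootProcess n (m n) x xs)
  have hemp : ∀ n ω, Φ (pathInLinf (empProcess (cdf ν) n (sample X n ω))
        (bv_empProcess ν n (sample X n ω))) =
      integralProcess h𝒢 (empProcess (cdf ν) n (sample X n ω))
        (bv_empProcess ν n (sample X n ω)) :=
    fun n ω => hΦ.apply_path _ _ (continuousWithinAt_empProcess ν n (sample X n ω))
  refine ⟨Zbar, ?_, ?_, ?_, fun h => ?_, fun h => ?_, fun h => ?_⟩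
  · refine isGaussianProcess_of_tendsto_ae (isGaussianProcess_riemannSum hZgauss 𝒢) fun g => ?_
    filter_upwards [hZcont, hae] with ω hω hω'
    rw [← hω']
    exact hΦ.tendsto_riemannSum_of_mem_closure hT (mem_closure_rightContBV hω) g
  · exact (hΦ.continuous.comp_aestronglyMeasurable hZm).congr hae
  · intro ω
    by_cases hω : UnifContFor (distL1 ν) (Φ (Z ω))
    · simpa only [Zbar, if_pos hω] using hω
    · intro ε hε
      refine ⟨1, one_pos, fun f g _ => ?_⟩
      simpa [Zbar, if_neg hω] using hε
  · simpa only [hboot] using condWeakInProb_congr_ae hae (h.comp hK hlip)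
  · simpa only [hboot] using condWeakAS_congr_ae hae (h.comp hK hlip)
  · simpa only [hemp] using h.comp hΦ.continuous hae
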